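/- Consider the loop nest 7NL CNN: for all $0\le i_1<N$, $0\le i_2<c_I$, $0\le i_3<c_O$, $0\le i_4<w_O$, $0\le i_5<h_O$, $0\le i_6<w_F$, $0\le i_7<h_F$ perform the update $$\mathrm{Output}(i_1,i_3,i_4,i_5)\mathrel{+}=\mathrm{Input}(i_1,i_2,\sigma_w i_4+i_6,\sigma_h i_5+i_7)\cdot\mathrm{Filter}(i_2,i_3,i_6,i_7),$$ where all sizes and the strides $\sigma_w,\sigma_h$ are positive integers with $\sigma_w\le w_F$ and $\sigma_h\le h_F$. The arrays Input (of dimensions $N\times c_I\times(w_F+\sigma_w w_O)\times(h_F+\sigma_h h_O)$), Filter ($c_I\times c_O\times w_F\times h_F$) and Output ($N\times c_O\times w_O\times h_O$) do not overlap, and each of their entries occupies $p_I$, $p_F$ and $p_O$ words respectively, with $p_I,p_F,p_O>0$ real. Let $G:=Nc_Ic_Ow_Oh_Ow_Fh_F$ be the number of updates. There are $P\ge 1$ processors, each with a local memory of $M>0$ words. The entries of the three arrays (Output included) are initially distributed, possibly with replication, over the local memories in any way, and may be anywhere at the end. An entry can afterwards enter a local memory only by being sent there from the memory of another processor that holds it;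 entries may be kept or dropped at will, but the entries held by a processor never exceed $M$ words in total. Each of the $G$ updates is performed once, in any order, by some processor at a time when it holds the three entries involved. Sending an entry costs its size in words, and the number of words communicated by a processor is the total number of words that it sends and receives. Then, for every such execution, some processor communicates at least $$\max\left\{\frac{C_pG}{PM}-M,\ \frac{2(p_Ip_Fp_O)^{1/2}(\sigma_w\sigma_h)^{1/2}G}{P\,(w_Fh_FM)^{1/2}}-2M\right\}$$ words, where $C_p=\frac14(p_I+p_F+p_O)^2$ if $p_j\le p_k+p_\ell$ for all distinct $j,k,\ell\in\{I,F,O\}$, and $C_p=p_j(p_k+p_\ell)$ if $p_j>p_k+p_\ell$ for some distinct $j,k,\ell$. -/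

import Mathlib

/-- The loop bounds and strides of one convolution layer (7NL CNN):
`N` images, `cI` input channels, `cO` output channels, output width and height `wO`, `hO`,
filter width and height `wF`, `hF`, horizontal and vertical strides `σw`, `σh`. -/
structure ConvLayer where
  N : ℕ
  cI : ℕ
  cO : ℕ
  wO : ℕ
  hO : ℕ
  wF : ℕ
  hF : ℕ
  σw : ℕ
  σh : ℕ

/-- The precisions: number of (32-bit) words occupied by one entry of the Input, Filter and
Output array.  They need not be integers. -/
structure Precisions where
  pI : ℝ
  pF : ℝ
  pO : ℝ

namespace Precisions

/-- The constant `C_p`: it is `(pI + pF + pO)² / 4` if the precisions satisfy the triangle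
inequalities, and `p_j (p_k + p_l)` if `p_j > p_k + p_l` (for positive precisions
this happens for at most one `j`). -/
noncomputable def C (p : Precisions) : ℝ :=
  if p.pI > p.pF + p.pO then p.pI * (p.pF + p.pO)
  else if p.pF > p.pI + p.pO then p.pF * (p.pI + p.pO)
  else if p.pO > p.pI + p.pF then p.pO * (p.pI + p.pF)
  else (p.pI + p.pF + p.pO) ^ 2 / 4

end Precisions

namespace ConvLayer

/-- The number of updates, `G = N c_I c_O w_O h_O w_F h_F`. -/
def G (L : ConvLayer) : ℕ := L.N * L.cI * L.cO * L.wO * L.hO * L.wF * L.hF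

/-- One update, i.e. one iteration `(i₁, …, i₇)` of the seven nested loops. -/
abbrev Update (L : ConvLayer) : Type :=
  Fin L.N × Fin L.cI × Fin L.cO × Fin L.wO × Fin L.hO × Fin L.wF × Fin L.hF

/-- Positions of the Input array, of dimensions
`N × c_I × (w_F + σ_w w_O) × (h_F + σ_h h_O)`. -/
abbrev InputIdx (L : ConvLayer) : Type :=
  Fin L.N × Fin L.cI × Fin (L.wF + L.σw * L.wO) × Fin (L.hF + L.σh * L.hO)

/-- Positions of the Filter array, of dimensions `c_I × c_O × w_F × h_F`. -/
abbrev FilterIdx (L : ConvLayer) : Type :=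
  Fin L.cI × Fin L.cO × Fin L.wF × Fin L.hF

/-- Positions of the Output array, of dimensions `N × c_O × w_O × h_O`. -/
abbrev OutputIdx (L : ConvLayer) : Type :=
  Fin L.N × Fin L.cO × Fin L.wO × Fin L.hO

/-- The data: the entries of the three non-overlapping arrays. -/
abbrev Entry (L : ConvLayer) : Type := L.InputIdx ⊕ L.FilterIdx ⊕ L.OutputIdx

/-- The coordinate `σ i + k` of the Input array. -/
def shift {s a b : ℕ} (i : Fin a) (k : Fin b) : Fin (b + s * a) :=
  ⟨s * i.val + k.val, by
    have h1 : s * i.val ≤ s * a := Nat.mul_le_mul_left s i.isLt.le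
    have h2 := k.isLt
    omega⟩

/-- The Input entry `(i₁, i₂, σ_w i₄ + i₆, σ_h i₅ + i₇)` read by an update. -/
def inputEntry (L : ConvLayer) : L.Update → L.Entry
  | (i₁, i₂, _, i₄, i₅, i₆, i₇) => Sum.inl (i₁, i₂, shift i₄ i₆, shift i₅ i₇)

/-- The Filter entry `(i₂, i₃, i₆, i₇)` read by an update. -/
def filterEntry (L : ConvLayer) : L.Update → L.Entry
  | (_, i₂, i₃, _, _, i₆, i₇) => Sum.inr (Sum.inl (i₂, i₃, i₆, i₇))

/-- The Output entry `(i₁, i₃, i₄, i₅)` to which an update adds its product. -/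
def outputEntry (L : ConvLayer) : L.Update → L.Entry
  | (i₁, _, i₃, i₄, i₅, _, _) => Sum.inr (Sum.inr (i₁, i₃, i₄, i₅))

/-- The size in words of an entry. -/
def size (L : ConvLayer) (p : Precisions) : L.Entry → ℝ :=
  Sum.elim (fun _ => p.pI) (Sum.elim (fun _ => p.pF) (fun _ => p.pO))

/-- The transmission of (the current local copy of) one entry from processor `src` to
processor `dst`. -/
structure Message (L : ConvLayer) (P : ℕ) where
  src : Fin P
  dst : Fin P
  entry : L.Entry

/-- An execution of all the updates, each once, in any order and on any of the `P` processors,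
in the distributed memory model with `M` words of local memory per processor.

Time is divided into steps.  `mem t q` is the set of entries of which processor `q` holds a
copy at time `t`; the initial distribution `mem 0` is arbitrary (replication is allowed), as is
the final one.  Between times `t` and `t + 1` the messages `msgs t` are transmitted, and every
processor may keep or drop anything that it held or that it received.  An update
`Output += Input * Filter` can be performed by a processor at a time at which its
local memory holds the three entries involved; local accesses and arithmetic are
free.  Several processors may hold copies (partial sums) of one Output entry; a message may
carry such a partial sum, to be added into a copy held by the receiver.  No condition is imposed
on how the partial sums are combined. -/
structure Execution (L : ConvLayer) (p : Precisions) (P : ℕ) (M : ℝ) where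
  /-- The number of communication steps. -/
  steps : ℕ
  /-- The contents of the local memories. -/
  mem : ℕ → Fin P → Finset L.Entry
  /-- The messages of each step. -/
  msgs : ℕ → Finset (L.Message P)
  /-- The processor that performs a given update. -/
  proc : L.Update → Fin P
  /-- The time at which a given update is performed. -/
  time : L.Update → ℕ
  capacity : ∀ t ≤ steps, ∀ q, ∑ e ∈ mem t q, L.size p e ≤ M
  src_ne_dst : ∀ t < steps, ∀ m ∈ msgs t, m.src ≠ m.dst
  src_holds : ∀ t < steps, ∀ m ∈ msgs t, m.entry ∈ mem t m.src
  mem_succ : ∀ t < steps, ∀ q, ∀ e ∈ mem (t + 1) q,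
    e ∈ mem t q ∨ ∃ m ∈ msgs t, m.dst = q ∧ m.entry = e
  time_le : ∀ i, time i ≤ steps
  input_mem : ∀ i, L.inputEntry i ∈ mem (time i) (proc i)
  filter_mem : ∀ i, L.filterEntry i ∈ mem (time i) (proc i)
  output_mem : ∀ i, L.outputEntry i ∈ mem (time i) (proc i)

/-- The number of words communicated by processor `q`, into and out of its local memory. -/
noncomputable def Execution.words {L : ConvLayer} {p : Precisions} {P : ℕ} {M : ℝ}
    (E : L.Execution p P M) (q : Fin P) : ℝ :=
  ∑ t ∈ Finset.range E.steps, ∑ m ∈ E.msgs t with m.src = q ∨ m.dst = q, L.size p m.entry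

end ConvLayer

/-!
Cut the execution at each processor into segments in which it receives less than `M` words. What
the processor holds during a segment was in its memory at the start or is received in the segment,
so the updates of a segment touch at most `2 M` words of entries (`Execution.exists_superset_mem`).
If `β` bounds the number of updates that `2 M` words support, a processor that receives `R` words
performs at most `(R / M + 1) β` updates; summing over processors bounds the total number of words
received from below (`Execution.card_le_sum_received`). It remains to bound `β`. Let a set `S` of
updates touch `X`, `Y`, `Z` input, filter and output entries, so that
`p_I X + p_F Y + p_O Z ≤ 2 M`.

* An update is determined by any two of its three entries, so `#S ≤ X Y, X Z, Y Z`, and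
  minimizing `p_I X + p_F Y + p_O Z` under these constraints gives `β = M² / C_p`
  (`Precisions.four_mul_C_mul_le`). This yields the first bound.
* If the filter coordinates in `S` are below `b σ_w` and `c σ_h`, then `(#S)² ≤ b c X Y Z`
  (`sq_card_le_of_lt_stride_mul`), whence `β² = b c (8/27) M³ / (p_I p_F p_O)`.

For the second bound one would like to take `b = w_F / σ_w` and `c = h_F / σ_h`, which need not be
integers. The loss is affordable: every message is counted both at its sender and at its receiver,
so the processors communicate on average twice what they receive, and the claim reduces to half its
main term for the words received. Hence it is possible to count only the updates in a window of the
filter positions that is covered by `b` and `c` full strides (`exists_window`), and to use segments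
of `M` words, which give the additive term the right size. A processor that communicates the most
then satisfies both bounds.
-/

open Finset

/-! ### Real inequalities -/

namespace Precisions

theorem C_pos (p : Precisions) (hI : 0 < p.pI) (hF : 0 < p.pF) (hO : 0 < p.pO) : 0 < p.C := by
  unfold C
  split_ifs <;> positivity

/-- If `X` is at most `√V` and the other two variables are at least `V / X`, the weighted sum
is at least what it is at `X = √V`, provided the weight of `X` is dominated by the other two. -/
theorem add_mul_sqrt_le {a b c X Y Z V : ℝ} (hb : 0 < b) (hc : 0 < c)
    (hX : 0 ≤ X) (hXV : X ≤ √V) (hV : 0 < V) (h : a ≤ b + c) (hY : V ≤ X * Y) (hZ : V ≤ X * Z) :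
    (a + b + c) * √V ≤ a * X + b * Y + c * Z := by
  set s := √V with hs
  have hs2 : s * s = V := Real.mul_self_sqrt hV.le
  have hs0 : 0 < s := Real.sqrt_pos.2 hV
  have hX0 : 0 < X := by
    rcases hX.eq_or_lt with h0 | h0
    · rw [← h0, zero_mul] at hY; linarith
    · exact h0
  refine le_of_mul_le_mul_left ?_ hX0
  have h1 : b * V ≤ b * (X * Y) := by gcongr
  have h2 : c * V ≤ c * (X * Z) := by gcongr
  -- `X` times the difference is at least `(s - X) * ((b + c) * s - a * X)`
  have h3 : 0 ≤ (s - X) * ((b + c) * s - a * X) := by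
    apply mul_nonneg (by linarith)
    nlinarith
  rw [← hs2] at h1 h2
  nlinarith

/-- If `V` is at most each of the products of two of `X`, `Y`, `Z`, then `4 C_p V` is at most the
square of the weighted sum `p_I X + p_F Y + p_O Z`. -/
theorem four_mul_C_mul_le (p : Precisions) (hI : 0 < p.pI) (hF : 0 < p.pF) (hO : 0 < p.pO)
    {X Y Z V : ℝ} (hX : 0 ≤ X) (hY : 0 ≤ Y) (hZ : 0 ≤ Z) (hV : 0 ≤ V)
    (hXY : V ≤ X * Y) (hXZ : V ≤ X * Z) (hYZ : V ≤ Y * Z) :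
    4 * p.C * V ≤ (p.pI * X + p.pF * Y + p.pO * Z) ^ 2 := by
  rcases hV.eq_or_lt with rfl | hV
  · rw [mul_zero]; positivity
  have key : ∀ {a b c X Y Z : ℝ}, 0 < a → 0 < b → 0 < c →
      V ≤ X * Y → V ≤ X * Z → 4 * (a * (b + c)) * V ≤ (a * X + b * Y + c * Z) ^ 2 := by
    intro a b c X Y Z ha hb hc h1 h2
    have h3 : (a * b) * V ≤ (a * b) * (X * Y) := by gcongr
    have h4 : (a * c) * V ≤ (a * c) * (X * Z) := by gcongr
    nlinarith [sq_nonneg (a * X - (b * Y + c * Z))]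
  have sq : ∀ {B : ℝ}, (p.pI + p.pF + p.pO) * √V ≤ B → (p.pI + p.pF + p.pO) ^ 2 * V ≤ B ^ 2 := by
    intro B h
    calc _ = ((p.pI + p.pF + p.pO) * √V) ^ 2 := by rw [mul_pow, Real.sq_sqrt hV.le]
      _ ≤ B ^ 2 := by gcongr
  have hYX : V ≤ Y * X := by linarith
  have hZX : V ≤ Z * X := by linarith
  have hZY : V ≤ Z * Y := by linarith
  unfold C
  split_ifs with h1 h2 h3
  · exact key hI hF hO hXY hXZ
  · have := key hF hI hO hYX hYZ
    rwa [add_comm (p.pF * Y)] at this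
  · have := key hO hI hF hZX hZY
    rwa [add_assoc, add_comm (p.pO * Z)] at this
  · rw [mul_div_cancel₀ _ (by norm_num : (4 : ℝ) ≠ 0)]
    apply sq
    rcases le_total X √V with hx | hx
    · exact add_mul_sqrt_le hF hO hX hx hV (by linarith) hXY hXZ
    rcases le_total Y √V with hy | hy
    · have := add_mul_sqrt_le hI hO hY hy hV (not_lt.1 h2) hYX hYZ
      linarith
    rcases le_total Z √V with hz | hz
    · have := add_mul_sqrt_le hI hF hZ hz hV (not_lt.1 h3) hZX hZY
      linarith
    rw [add_mul, add_mul]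
    gcongr

end Precisions

/-- The inequality of arithmetic and geometric means for three variables. -/
theorem mul_mul_le_of_add_le {x y z B : ℝ} (hx : 0 ≤ x) (hy : 0 ≤ y) (hz : 0 ≤ z)
    (h : x + y + z ≤ B) : 27 * (x * y * z) ≤ B ^ 3 := by
  calc 27 * (x * y * z) ≤ (x + y + z) ^ 3 := by
        nlinarith [mul_nonneg hx (sq_nonneg (y - z)), mul_nonneg hy (sq_nonneg (x - z)),
          mul_nonneg hz (sq_nonneg (x - y)), mul_nonneg hx (sq_nonneg (x - y)),
          mul_nonneg hx (sq_nonneg (x - z)), mul_nonneg hy (sq_nonneg (y - z)),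
          mul_nonneg hy (sq_nonneg (x - y)), mul_nonneg hz (sq_nonneg (x - z)),
          mul_nonneg hz (sq_nonneg (y - z))]
    _ ≤ B ^ 3 := by gcongr

/-- A window of `u` of the `f` filter positions that loses little: it is covered by `b` full
strides, and `u² / (b σ f) ≥ 3/5`. -/
theorem exists_window {σ f : ℕ} (hσ : 0 < σ) (hf : σ ≤ f) :
    ∃ b u : ℕ, 0 < u ∧ u ≤ f ∧ u ≤ σ * b ∧ 3 * (b * σ * f) ≤ 5 * u ^ 2 := by
  have hn : 1 ≤ f / σ := (Nat.one_le_div_iff hσ).2 hf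
  have h1 : σ * (f / σ) ≤ f := Nat.mul_div_le f σ
  have h2 : f < σ * (f / σ + 1) := by
    rw [mul_comm]; exact Nat.lt_mul_of_div_lt (Nat.lt_succ_self _) hσ
  generalize f / σ = n at hn h1 h2
  -- use all positions if they nearly fill the last stride, and only the complete strides if not
  by_cases h : 3 * (σ * (n + 1)) ≤ 5 * f
  · exact ⟨n + 1, f, hσ.trans_le hf, le_rfl, h2.le, by nlinarith⟩
  · refine ⟨n, σ * n, Nat.mul_pos hσ hn, h1, le_rfl, ?_⟩
    have : 3 * f ≤ 5 * (σ * n) := by nlinarith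
    nlinarith [Nat.mul_le_mul_right (σ * n) this]

/-- By the Cauchy-Schwarz inequality, a set of `n` points whose image has `m` points has at least
`n² / m` pairs of points with the same image. -/
theorem sq_card_le_card_image_mul_card_pairs {α β : Type*} [DecidableEq β]
    (s : Finset α) (f : α → β) :
    #s ^ 2 ≤ #(s.image f) * #{x ∈ s ×ˢ s | f x.1 = f x.2} := by
  have h1 : #s = ∑ b ∈ s.image f, #{x ∈ s | f x = b} :=
    card_eq_sum_card_image f s
  have h2 : #{x ∈ s ×ˢ s | f x.1 = f x.2} = ∑ b ∈ s.image f, #{x ∈ s | f x = b} ^ 2 := by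
    rw [card_eq_sum_card_fiberwise (f := fun x => f x.1) (t := s.image f)]
    · refine sum_congr rfl fun b _ => ?_
      rw [sq, ← card_product]
      congr 1
      ext ⟨x, y⟩
      simp only [mem_filter, mem_product]
      constructor
      · rintro ⟨⟨⟨hx, hy⟩, h⟩, rfl⟩
        exact ⟨⟨hx, rfl⟩, hy, h.symm⟩
      · rintro ⟨⟨hx, rfl⟩, hy, h⟩
        exact ⟨⟨⟨hx, hy⟩, h.symm⟩, rfl⟩
    · rintro ⟨x, y⟩ h
      simp only [coe_filter, mem_product, Set.mem_ofPred_eq] at h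
      exact mem_coe.2 (mem_image_of_mem f h.1.1)
  rw [h2, h1]
  exact sq_sum_le_card_mul_sum_sq

namespace ConvLayer

variable {L : ConvLayer} {p : Precisions}

/-! ### How many updates a set of entries supports -/

theorem shift_eq_shift_iff {s a b : ℕ} {i i' : Fin a} {k k' : Fin b} :
    (shift i k : Fin (b + s * a)) = shift i' k' ↔ s * i.val + k.val = s * i'.val + k'.val := by
  simp [shift, Fin.ext_iff]

theorem shift_right_injective {s a b : ℕ} {i : Fin a} {k k' : Fin b}
    (h : (shift i k : Fin (b + s * a)) = shift i k') : k = k' := by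
  rw [shift_eq_shift_iff] at h
  exact Fin.ext (by omega)

theorem shift_left_injective {s a b : ℕ} (hs : 0 < s) {i i' : Fin a} {k : Fin b}
    (h : (shift i k : Fin (b + s * a)) = shift i' k) : i = i' := by
  rw [shift_eq_shift_iff] at h
  exact Fin.ext (Nat.eq_of_mul_eq_mul_left hs (by omega))

/-- The coordinate `s i + k` and the quotient of `k` by `s` determine `i` and `k`, as they
determine the remainder of `k`. -/
theorem shift_div_injective {s a b : ℕ} (hs : 0 < s) {i i' : Fin a} {k k' : Fin b}
    (h : (shift i k : Fin (b + s * a)) = shift i' k') (hk : k.val / s = k'.val / s) :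
    i = i' ∧ k = k' := by
  have h' := shift_eq_shift_iff.1 h
  have hm : k.val % s = k'.val % s := by
    simpa [Nat.mul_add_mod] using congrArg (· % s) h'
  have hkk : k = k' := by
    apply Fin.ext
    rw [← Nat.div_add_mod k.val s, ← Nat.div_add_mod k'.val s, hk, hm]
  subst hkk
  exact ⟨shift_left_injective hs h, rfl⟩

theorem card_le_card_image_mul_card_image {α β γ : Type*} [DecidableEq β] [DecidableEq γ]
    (S : Finset α) {f : α → β} {g : α → γ} (h : ∀ i j, f i = f j → g i = g j → i = j) :
    #S ≤ #(S.image f) * #(S.image g) := by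
  rw [← card_product]
  refine card_le_card_of_injOn (fun i => (f i, g i)) (fun i hi => ?_) fun i _ j _ hij => ?_
  · exact mem_coe.2 (mem_product.2 ⟨mem_image_of_mem f hi, mem_image_of_mem g hi⟩)
  · exact h i j (Prod.ext_iff.1 hij).1 (Prod.ext_iff.1 hij).2

theorem card_le_input_mul_filter (hσw : 0 < L.σw) (hσh : 0 < L.σh) (S : Finset L.Update) :
    #S ≤ #(S.image L.inputEntry) * #(S.image L.filterEntry) := by
  refine card_le_card_image_mul_card_image S ?_
  rintro ⟨i₁, i₂, i₃, i₄, i₅, i₆, i₇⟩ ⟨j₁, j₂, j₃, j₄, j₅, j₆, j₇⟩ h h'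
  simp only [inputEntry, filterEntry, Sum.inl.injEq, Sum.inr.injEq, Prod.mk.injEq] at h h'
  obtain ⟨rfl, rfl, h4, h5⟩ := h
  obtain ⟨-, rfl, rfl, rfl⟩ := h'
  rw [shift_left_injective hσw h4, shift_left_injective hσh h5]

theorem card_le_input_mul_output (S : Finset L.Update) :
    #S ≤ #(S.image L.inputEntry) * #(S.image L.outputEntry) := by
  refine card_le_card_image_mul_card_image S ?_
  rintro ⟨i₁, i₂, i₃, i₄, i₅, i₆, i₇⟩ ⟨j₁, j₂, j₃, j₄, j₅, j₆, j₇⟩ h h'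
  simp only [inputEntry, outputEntry, Sum.inl.injEq, Sum.inr.injEq, Prod.mk.injEq] at h h'
  obtain ⟨rfl, rfl, h4, h5⟩ := h
  obtain ⟨-, rfl, rfl, rfl⟩ := h'
  rw [shift_right_injective h4, shift_right_injective h5]

theorem card_le_filter_mul_output (S : Finset L.Update) :
    #S ≤ #(S.image L.filterEntry) * #(S.image L.outputEntry) := by
  refine card_le_card_image_mul_card_image S ?_
  rintro ⟨i₁, i₂, i₃, i₄, i₅, i₆, i₇⟩ ⟨j₁, j₂, j₃, j₄, j₅, j₆, j₇⟩ h h'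
  simp only [filterEntry, outputEntry, Sum.inr.injEq, Sum.inl.injEq, Prod.mk.injEq] at h h'
  obtain ⟨rfl, rfl, rfl, rfl⟩ := h
  obtain ⟨rfl, -, rfl, rfl⟩ := h'
  rfl

/-- A Loomis-Whitney inequality with strides. A pair `(v, v')` of updates with the same output
entry is determined by the input entry of `v`, the filter entry of `v'`, and the quotients by the
strides of the filter coordinates of `v`, of which there are at most `b * c`. -/
theorem sq_card_le_of_lt_stride_mul (hσw : 0 < L.σw) (hσh : 0 < L.σh) {b c : ℕ}
    (S : Finset L.Update)
    (hS : ∀ i ∈ S, i.2.2.2.2.2.1.val < L.σw * b ∧ i.2.2.2.2.2.2.val < L.σh * c) :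
    #S ^ 2 ≤ b * c * (#(S.image L.inputEntry) * #(S.image L.filterEntry)
      * #(S.image L.outputEntry)) := by
  have key : #{x ∈ S ×ˢ S | L.outputEntry x.1 = L.outputEntry x.2} ≤
      #(S.image L.inputEntry ×ˢ S.image L.filterEntry ×ˢ range b ×ˢ range c) := by
    refine card_le_card_of_injOn (fun x => (L.inputEntry x.1, L.filterEntry x.2,
      x.1.2.2.2.2.2.1.val / L.σw, x.1.2.2.2.2.2.2.val / L.σh)) ?_ ?_
    · intro x hx
      simp only [coe_filter, mem_product, Set.mem_ofPred_eq] at hx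
      simp only [mem_coe, mem_product, mem_range]
      exact ⟨mem_image_of_mem _ hx.1.1, mem_image_of_mem _ hx.1.2,
        Nat.div_lt_of_lt_mul (hS _ hx.1.1).1, Nat.div_lt_of_lt_mul (hS _ hx.1.1).2⟩
    · rintro ⟨⟨i₁, i₂, i₃, i₄, i₅, i₆, i₇⟩, ⟨i₁', i₂', i₃', i₄', i₅', i₆', i₇'⟩⟩ hx
        ⟨⟨j₁, j₂, j₃, j₄, j₅, j₆, j₇⟩, ⟨j₁', j₂', j₃', j₄', j₅', j₆', j₇'⟩⟩ hy h
      simp only [coe_filter, mem_product, Set.mem_ofPred_eq, outputEntry, inputEntry, filterEntry,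
        Sum.inr.injEq, Sum.inl.injEq, Prod.mk.injEq] at hx hy h
      obtain ⟨-, rfl, rfl, rfl, rfl⟩ := hx
      obtain ⟨-, rfl, rfl, rfl, rfl⟩ := hy
      obtain ⟨⟨rfl, rfl, h4, h5⟩, ⟨rfl, rfl, rfl, rfl⟩, h6, h7⟩ := h
      obtain ⟨rfl, rfl⟩ := shift_div_injective hσw h4 h6
      obtain ⟨rfl, rfl⟩ := shift_div_injective hσh h5 h7
      rfl
  calc #S ^ 2 ≤ _ := sq_card_le_card_image_mul_card_pairs S L.outputEntry
    _ ≤ _ := Nat.mul_le_mul_left _ key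
    _ = _ := by simp only [card_product, card_range]; ring

theorem size_nonneg (hI : 0 < p.pI) (hF : 0 < p.pF) (hO : 0 < p.pO) (e : L.Entry) :
    0 ≤ L.size p e := by
  rcases e with e | e | e <;> simp [size, hI.le, hF.le, hO.le]

/-- The words occupied by the entries of the updates `S` are counted by the three images, as the
arrays do not overlap. -/
theorem footprint_le (hI : 0 < p.pI) (hF : 0 < p.pF) (hO : 0 < p.pO) {S : Finset L.Update}
    {D : Finset L.Entry} (hS : ∀ i ∈ S, L.inputEntry i ∈ D ∧ L.filterEntry i ∈ D ∧
      L.outputEntry i ∈ D) :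
    p.pI * #(S.image L.inputEntry) + p.pF * #(S.image L.filterEntry)
      + p.pO * #(S.image L.outputEntry) ≤ ∑ e ∈ D, L.size p e := by
  have hsum : ∀ (f : L.Update → L.Entry) (c : ℝ), (∀ i, L.size p (f i) = c) →
      ∑ e ∈ S.image f, L.size p e = c * #(S.image f) := by
    intro f c hf
    have h : ∀ e ∈ S.image f, L.size p e = c := by
      intro e he
      obtain ⟨i, -, rfl⟩ := mem_image.1 he
      exact hf i
    rw [sum_congr rfl h, sum_const, nsmul_eq_mul, mul_comm]
  have d1 : Disjoint (S.image L.inputEntry) (S.image L.filterEntry) := by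
    simp [disjoint_left, inputEntry, filterEntry]
  have d2 : Disjoint (S.image L.inputEntry ∪ S.image L.filterEntry) (S.image L.outputEntry) := by
    rw [disjoint_union_left]
    constructor <;> simp [disjoint_left, inputEntry, filterEntry, outputEntry]
  rw [← hsum L.inputEntry p.pI fun _ => rfl, ← hsum L.filterEntry p.pF fun _ => rfl,
    ← hsum L.outputEntry p.pO fun _ => rfl, ← sum_union d1, ← sum_union d2]
  refine sum_le_sum_of_subset_of_nonneg ?_ fun e _ _ => size_nonneg hI hF hO e
  refine union_subset (union_subset ?_ ?_) ?_
  · exact image_subset_iff.2 fun i hi => (hS i hi).1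
  · exact image_subset_iff.2 fun i hi => (hS i hi).2.1
  · exact image_subset_iff.2 fun i hi => (hS i hi).2.2

/-- The number of updates supported by `2 M` words, from the products of two of the arrays. -/
theorem card_le_sq_div_C (hI : 0 < p.pI) (hF : 0 < p.pF) (hO : 0 < p.pO)
    (hσw : 0 < L.σw) (hσh : 0 < L.σh) {M : ℝ} {S : Finset L.Update} {D : Finset L.Entry}
    (hS : ∀ i ∈ S, L.inputEntry i ∈ D ∧ L.filterEntry i ∈ D ∧ L.outputEntry i ∈ D)
    (hD : ∑ e ∈ D, L.size p e ≤ 2 * M) : (#S : ℝ) ≤ M ^ 2 / p.C := by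
  have h1 := footprint_le hI hF hO hS
  have h2 := p.four_mul_C_mul_le hI hF hO (V := #S) (X := #(S.image L.inputEntry))
    (Y := #(S.image L.filterEntry)) (Z := #(S.image L.outputEntry))
    (by positivity) (by positivity) (by positivity) (by positivity)
    (mod_cast card_le_input_mul_filter hσw hσh S) (mod_cast card_le_input_mul_output S)
    (mod_cast card_le_filter_mul_output S)
  rw [le_div_iff₀ (p.C_pos hI hF hO)]
  have h3 : (p.pI * #(S.image L.inputEntry) + p.pF * #(S.image L.filterEntry)
      + p.pO * #(S.image L.outputEntry)) ^ 2 ≤ (2 * M) ^ 2 := by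
    gcongr
    exact h1.trans hD
  linarith

/-- The number of updates in a window of filter positions supported by `2 M` words, from the
Loomis-Whitney inequality. -/
theorem card_le_sqrt_of_lt_stride_mul (hI : 0 < p.pI) (hF : 0 < p.pF) (hO : 0 < p.pO)
    (hσw : 0 < L.σw) (hσh : 0 < L.σh) {M : ℝ} {b c : ℕ} {S : Finset L.Update}
    {D : Finset L.Entry}
    (hbc : ∀ i ∈ S, i.2.2.2.2.2.1.val < L.σw * b ∧ i.2.2.2.2.2.2.val < L.σh * c)
    (hS : ∀ i ∈ S, L.inputEntry i ∈ D ∧ L.filterEntry i ∈ D ∧ L.outputEntry i ∈ D)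
    (hD : ∑ e ∈ D, L.size p e ≤ 2 * M) :
    (#S : ℝ) ≤ √(b * c * (8 / 27 * M ^ 3) / (p.pI * p.pF * p.pO)) := by
  apply Real.le_sqrt_of_sq_le
  have h1 : (#S : ℝ) ^ 2 ≤ b * c * (#(S.image L.inputEntry) * #(S.image L.filterEntry)
      * #(S.image L.outputEntry)) := mod_cast sq_card_le_of_lt_stride_mul hσw hσh S hbc
  have h2 := mul_mul_le_of_add_le (by positivity) (by positivity) (by positivity)
    ((footprint_le hI hF hO hS).trans hD)
  rw [le_div_iff₀ (by positivity)]
  calc _ ≤ b * c * (#(S.image L.inputEntry) * #(S.image L.filterEntry)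
      * #(S.image L.outputEntry)) * (p.pI * p.pF * p.pO) := by gcongr
    _ = b * c * (p.pI * #(S.image L.inputEntry) * (p.pF * #(S.image L.filterEntry))
      * (p.pO * #(S.image L.outputEntry))) := by ring
    _ ≤ _ := mul_le_mul_of_nonneg_left (by linarith) (by positivity)

/-- The number of updates whose filter coordinates lie in a `u × v` window. -/
theorem card_window {u v : ℕ} (hu : u ≤ L.wF) (hv : v ≤ L.hF) :
    #{i : L.Update | i.2.2.2.2.2.1.val < u ∧ i.2.2.2.2.2.2.val < v} * (L.wF * L.hF)
      = L.G * (u * v) := by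
  have h : ({i : L.Update | i.2.2.2.2.2.1.val < u ∧ i.2.2.2.2.2.2.val < v} : Finset L.Update)
      = univ ×ˢ univ ×ˢ univ ×ˢ univ ×ˢ univ ×ˢ
        ({k | k.val < u} : Finset (Fin L.wF)) ×ˢ ({k | k.val < v} : Finset (Fin L.hF)) := by
    ext; simp
  have hc : ∀ {n m : ℕ}, m ≤ n → #{k : Fin n | k.val < m} = m := by
    intro n m hm
    rw [Fin.card_filter_val_lt]
    exact min_eq_right hm
  rw [h]
  simp only [card_product, card_univ, Fintype.card_fin, hc hu, hc hv, G]
  ring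

/-! ### Segments of an execution -/

namespace Execution

variable {P : ℕ} {M : ℝ}

/-- The number of words received by processor `q` in the first `t` steps. -/
noncomputable def received (E : L.Execution p P M) (q : Fin P) (t : ℕ) : ℝ :=
  ∑ s ∈ range t, ∑ m ∈ E.msgs s with m.dst = q, L.size p m.entry

theorem received_mono (hI : 0 < p.pI) (hF : 0 < p.pF) (hO : 0 < p.pO)
    (E : L.Execution p P M) (q : Fin P) : Monotone (E.received q) := by
  intro s t hst
  exact sum_le_sum_of_subset_of_nonneg (range_subset_range.2 hst) fun _ _ _ =>
    sum_nonneg fun _ _ => size_nonneg hI hF hO _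

/-- Every message is counted at exactly two processors. -/
theorem sum_words (E : L.Execution p P M) :
    ∑ q, E.words q = 2 * ∑ q, E.received q E.steps := by
  simp only [words, received]
  rw [sum_comm, sum_comm (s := univ), mul_sum]
  refine sum_congr rfl fun t ht => ?_
  have ht' := mem_range.1 ht
  simp only [sum_filter]
  rw [sum_comm, sum_comm (s := univ), mul_sum]
  refine sum_congr rfl fun m hm => ?_
  have hne := E.src_ne_dst t ht' m hm
  have : ∀ q : Fin P, (if m.src = q ∨ m.dst = q then L.size p m.entry else 0)
      = (if m.src = q then L.size p m.entry else 0)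
        + (if m.dst = q then L.size p m.entry else 0) := by
    intro q
    by_cases h1 : m.src = q <;> by_cases h2 : m.dst = q
    · exact absurd (h1.trans h2.symm) hne
    all_goals simp [h1, h2]
  simp only [this, sum_add_distrib, sum_ite_eq, mem_univ, if_true]
  ring

/-- All that a processor holds during the time interval `[a, b]` was there at time `a` or is
received between `a` and `b`. -/
theorem exists_superset_mem (hI : 0 < p.pI) (hF : 0 < p.pF) (hO : 0 < p.pO)
    (E : L.Execution p P M) (q : Fin P) {a b : ℕ} (hab : a ≤ b) (hb : b ≤ E.steps) :
    ∃ D : Finset L.Entry, (∀ t, a ≤ t → t ≤ b → E.mem t q ⊆ D) ∧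
      ∑ e ∈ D, L.size p e ≤ M + (E.received q b - E.received q a) := by
  induction b, hab using Nat.le_induction with
  | base =>
    refine ⟨E.mem a q, fun t h1 h2 => by rw [le_antisymm h2 h1], ?_⟩
    rw [sub_self, add_zero]
    exact E.capacity a hb q
  | succ b hab ih =>
    obtain ⟨D, hD, hsize⟩ := ih (by omega)
    refine ⟨D ∪ ((E.msgs b).filter fun m => m.dst = q).image Message.entry, fun t h1 h2 => ?_, ?_⟩
    · rcases Nat.le_succ_iff.1 h2 with h2 | rfl
      · exact (hD t h1 h2).trans subset_union_left
      · intro e he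
        rcases E.mem_succ b (by omega) q e he with h | ⟨m, hm, hq, rfl⟩
        · exact mem_union_left _ (hD b hab le_rfl h)
        · exact mem_union_right _ (mem_image_of_mem _ (mem_filter.2 ⟨hm, hq⟩))
    · have h1 : E.received q (b + 1) = E.received q b
          + ∑ m ∈ E.msgs b with m.dst = q, L.size p m.entry := sum_range_succ _ _
      have h2 : ∑ e ∈ ((E.msgs b).filter fun m => m.dst = q).image Message.entry, L.size p e
          ≤ ∑ m ∈ E.msgs b with m.dst = q, L.size p m.entry :=
        sum_image_le_of_nonneg fun _ _ => size_nonneg hI hF hO _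
      have h3 := sum_union_inter (s₁ := D)
        (s₂ := ((E.msgs b).filter fun m => m.dst = q).image Message.entry) (f := L.size p)
      have h4 : 0 ≤ ∑ e ∈ D ∩ ((E.msgs b).filter fun m => m.dst = q).image Message.entry,
          L.size p e := sum_nonneg fun _ _ => size_nonneg hI hF hO _
      linarith

/-- Cut the execution at `q` into segments in each of which `q` receives less than `M` words.
The entries that `q` holds at some time of a segment occupy at most `2 M` words, so if such a set
of entries supports at most `β` of the updates `U`, then `q` performs at most `β` of them in each
segment. -/
theorem card_proc_le (hM : 0 < M) (hI : 0 < p.pI) (hF : 0 < p.pF) (hO : 0 < p.pO)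
    (E : L.Execution p P M) (q : Fin P) (U : Finset L.Update) {β : ℝ} (hβ : 0 ≤ β)
    (h : ∀ S ⊆ U, ∀ D : Finset L.Entry,
      (∀ i ∈ S, L.inputEntry i ∈ D ∧ L.filterEntry i ∈ D ∧ L.outputEntry i ∈ D) →
      ∑ e ∈ D, L.size p e ≤ 2 * M → (#S : ℝ) ≤ β) :
    (#{i ∈ U | E.proc i = q} : ℝ) ≤ (E.received q E.steps / M + 1) * β := by
  have hmono := E.received_mono hI hF hO q
  have hnn : ∀ t, 0 ≤ E.received q t := fun t => hmono (Nat.zero_le t)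
  set seg : L.Update → ℕ := fun i => ⌊E.received q (E.time i) / M⌋₊ with hseg
  have hfib : ∀ k, (#{i ∈ U.filter (E.proc · = q) | seg i = k} : ℝ) ≤ β := by
    intro k
    set S := {i ∈ U.filter (E.proc · = q) | seg i = k} with hS
    rcases S.eq_empty_or_nonempty with h0 | hne
    · rw [h0]; simpa using hβ
    obtain ⟨i, hi, hmin⟩ := S.exists_min_image E.time hne
    obtain ⟨j, hj, hmax⟩ := S.exists_max_image E.time hne
    obtain ⟨D, hD, hsize⟩ := E.exists_superset_mem hI hF hO q (hmin j hj) (E.time_le j)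
    have hSq : ∀ x ∈ S, E.proc x = q := fun x hx => (mem_filter.1 (mem_filter.1 hx).1).2
    refine h S (fun x hx => (mem_filter.1 (mem_filter.1 hx).1).1) D (fun x hx => ?_) ?_
    · have hsub := hD (E.time x) (hmin x hx) (hmax x hx)
      rw [← hSq x hx] at hsub
      exact ⟨hsub (E.input_mem x), hsub (E.filter_mem x), hsub (E.output_mem x)⟩
    · have h1 : (k : ℝ) ≤ E.received q (E.time i) / M := by
        rw [← (mem_filter.1 hi).2]
        exact Nat.floor_le (div_nonneg (hnn _) hM.le)
      have h2 : E.received q (E.time j) / M < k + 1 := by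
        rw [← (mem_filter.1 hj).2]
        exact Nat.lt_floor_add_one _
      rw [le_div_iff₀ hM] at h1
      rw [div_lt_iff₀ hM] at h2
      linarith
  have hmaps : ∀ i ∈ U.filter (E.proc · = q),
      seg i ∈ range (⌊E.received q E.steps / M⌋₊ + 1) := by
    intro i _
    rw [mem_range, Nat.lt_succ_iff]
    exact Nat.floor_le_floor (div_le_div_of_nonneg_right (hmono (E.time_le i)) hM.le)
  rw [card_eq_sum_card_fiberwise hmaps, Nat.cast_sum]
  calc _ ≤ #(range (⌊E.received q E.steps / M⌋₊ + 1)) • β :=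
        sum_le_card_nsmul _ _ _ fun k _ => hfib k
    _ = (⌊E.received q E.steps / M⌋₊ + 1) * β := by simp
    _ ≤ _ := by
      gcongr
      exact Nat.floor_le (div_nonneg (hnn _) hM.le)

theorem card_le_sum_received (hM : 0 < M) (hI : 0 < p.pI) (hF : 0 < p.pF) (hO : 0 < p.pO)
    (E : L.Execution p P M) (U : Finset L.Update) {β : ℝ} (hβ : 0 ≤ β)
    (h : ∀ S ⊆ U, ∀ D : Finset L.Entry,
      (∀ i ∈ S, L.inputEntry i ∈ D ∧ L.filterEntry i ∈ D ∧ L.outputEntry i ∈ D) →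
      ∑ e ∈ D, L.size p e ≤ 2 * M → (#S : ℝ) ≤ β) :
    (#U : ℝ) ≤ ((∑ q, E.received q E.steps) / M + P) * β := by
  rw [card_eq_sum_card_fiberwise (f := E.proc) (t := univ) (fun _ _ => by simp), Nat.cast_sum]
  calc _ ≤ ∑ q, (E.received q E.steps / M + 1) * β :=
        sum_le_sum fun q _ => E.card_proc_le hM hI hF hO q U hβ h
    _ = _ := by rw [← sum_mul, sum_add_distrib, sum_div]; simp

/-! ### The two lower bounds on the total communication -/

theorem sub_le_sum_received (hM : 0 < M) (hI : 0 < p.pI) (hF : 0 < p.pF) (hO : 0 < p.pO)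
    (hσw : 0 < L.σw) (hσh : 0 < L.σh) (E : L.Execution p P M) :
    p.C * L.G / M - P * M ≤ ∑ q, E.received q E.steps := by
  have hC := p.C_pos hI hF hO
  have h := E.card_le_sum_received hM hI hF hO univ (β := M ^ 2 / p.C) (by positivity)
    fun S _ D hS hD => card_le_sq_div_C hI hF hO hσw hσh hS hD
  have hG : #(univ : Finset L.Update) = L.G := by
    simp only [card_univ, Fintype.card_prod, Fintype.card_fin, G]; ring
  rw [hG, mul_div_assoc', le_div_iff₀ hC] at h
  rw [sub_le_iff_le_add, div_le_iff₀ hM]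
  calc p.C * L.G = L.G * p.C := mul_comm _ _
    _ ≤ _ := h
    _ = _ := by field_simp

/-- The main term is half of that claimed for the words communicated, and the additive term is
half as well. -/
theorem sqrt_sub_le_sum_received (hM : 0 < M) (hI : 0 < p.pI) (hF : 0 < p.pF) (hO : 0 < p.pO)
    (hσw : 0 < L.σw) (hσh : 0 < L.σh) (hw : L.σw ≤ L.wF) (hh : L.σh ≤ L.hF)
    (E : L.Execution p P M) :
    √(p.pI * p.pF * p.pO) * √((L.σw : ℝ) * (L.σh : ℝ)) * L.G / √((L.wF : ℝ) * (L.hF : ℝ) * M)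
      - P * M ≤ ∑ q, E.received q E.steps := by
  obtain ⟨b, u, hu0, hu, hub, hb⟩ := exists_window hσw hw
  obtain ⟨c, v, hv0, hv, hvc, hc⟩ := exists_window hσh hh
  set U : Finset L.Update := {i | i.2.2.2.2.2.1.val < u ∧ i.2.2.2.2.2.2.val < v} with hU
  have h := E.card_le_sum_received hM hI hF hO U (Real.sqrt_nonneg _)
    fun S hSU D hS hD => card_le_sqrt_of_lt_stride_mul hI hF hO hσw hσh (b := b) (c := c)
      (fun i hi => by
        have := (mem_filter.1 (hSU hi)).2
        exact ⟨this.1.trans_le hub, this.2.trans_le hvc⟩) hS hD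
  set R := ∑ q, E.received q E.steps
  have hcard : (#U : ℝ) * (L.wF * L.hF) = L.G * (u * v) := mod_cast card_window hu hv
  have hwF : (0 : ℝ) < L.wF := by exact_mod_cast hσw.trans_le hw
  have hhF : (0 : ℝ) < L.hF := by exact_mod_cast hσh.trans_le hh
  have hR : 0 ≤ R / M + P := by
    have : 0 ≤ R := sum_nonneg fun q _ => E.received_mono hI hF hO q (Nat.zero_le _)
    positivity
  -- the loss `(3/5)²` of the two windows is covered by the gain `27/8` of shorter segments
  have hwin : (8 / 27 : ℝ) * (b * c) * (L.σw * L.σh * (L.wF * L.hF)) ≤ (u * v) ^ 2 := by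
    have hb' : (3 : ℝ) * (b * L.σw * L.wF) ≤ 5 * u ^ 2 := mod_cast hb
    have hc' : (3 : ℝ) * (c * L.σh * L.hF) ≤ 5 * v ^ 2 := mod_cast hc
    have := mul_le_mul hb' hc' (by positivity) (by positivity)
    have h0 : (0 : ℝ) ≤ b * L.σw * L.wF * (c * L.σh * L.hF) := by positivity
    nlinarith
  rw [sub_le_iff_le_add, div_le_iff₀ (by positivity)]
  have h2 : (#U : ℝ) ^ 2
      ≤ (R / M + P) ^ 2 * (b * c * (8 / 27 * M ^ 3) / (p.pI * p.pF * p.pO)) := by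
    have h' := pow_le_pow_left₀ (by positivity) h 2
    rwa [mul_pow, Real.sq_sqrt (by positivity)] at h'
  have h3 : (#U : ℝ) ^ 2 * (p.pI * p.pF * p.pO) ≤ (R + P * M) ^ 2 * (8 / 27 * (b * c) * M) := by
    rw [mul_div_assoc', le_div_iff₀ (by positivity)] at h2
    calc _ ≤ _ := h2
      _ = _ := by field_simp
  have hRM : 0 ≤ R + P * M := by
    have : R + P * M = (R / M + P) * M := by field_simp
    rw [this]; positivity
  refine (pow_le_pow_iff_left₀ (by positivity) (by positivity) two_ne_zero).1 ?_
  have huv : (0 : ℝ) < (u * v) ^ 2 := by positivity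
  refine le_of_mul_le_mul_right ?_ huv
  simp only [mul_pow]
  rw [Real.sq_sqrt (by positivity), Real.sq_sqrt (by positivity), Real.sq_sqrt (by positivity)]
  calc p.pI * p.pF * p.pO * (L.σw * L.σh) * (L.G : ℝ) ^ 2 * ((u : ℝ) ^ 2 * (v : ℝ) ^ 2)
      = L.σw * L.σh * (p.pI * p.pF * p.pO) * (L.G * (u * v)) ^ 2 := by ring
    _ = L.σw * L.σh * (L.wF * L.hF) ^ 2 * ((#U : ℝ) ^ 2 * (p.pI * p.pF * p.pO)) := by
        rw [← hcard]; ring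
    _ ≤ L.σw * L.σh * (L.wF * L.hF) ^ 2 * ((R + P * M) ^ 2 * (8 / 27 * (b * c) * M)) := by gcongr
    _ = (R + P * M) ^ 2 * (L.wF * L.hF * M)
          * ((8 / 27 : ℝ) * (b * c) * (L.σw * L.σh * (L.wF * L.hF))) := by ring
    _ ≤ (R + P * M) ^ 2 * (L.wF * L.hF * M) * (u * v) ^ 2 := by gcongr
    _ = _ := by ring

end Execution

end ConvLayer

theorem theorem2 (L : ConvLayer) (p : Precisions) (P : ℕ) (M : ℝ)
    (hP : 0 < P) (hM : 0 < M)
    (hpI : 0 < p.pI) (hpF : 0 < p.pF) (hpO : 0 < p.pO)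
    (hσw : 0 < L.σw) (hσh : 0 < L.σh) (hw : L.σw ≤ L.wF) (hh : L.σh ≤ L.hF)
    (E : L.Execution p P M) :
    ∃ q : Fin P,
      max (p.C * (L.G : ℝ) / ((P : ℝ) * M) - M)
        (2 * √(p.pI * p.pF * p.pO) * √((L.σw : ℝ) * (L.σh : ℝ)) * (L.G : ℝ)
          / ((P : ℝ) * √((L.wF : ℝ) * (L.hF : ℝ) * M)) - 2 * M)
        ≤ E.words q := by
  have : Nonempty (Fin P) := ⟨⟨0, hP⟩⟩
  obtain ⟨q, -, hq⟩ := univ.exists_max_image E.words univ_nonempty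
  have hP' : (0 : ℝ) < P := mod_cast hP
  have hsum : 2 * ∑ q, E.received q E.steps ≤ P * E.words q := by
    rw [← E.sum_words]
    simpa using sum_le_card_nsmul univ E.words (E.words q) fun i _ => hq i (mem_univ i)
  have hR : 0 ≤ ∑ q, E.received q E.steps :=
    sum_nonneg fun q _ => E.received_mono hpI hpF hpO q (Nat.zero_le _)
  have h1 := E.sub_le_sum_received hM hpI hpF hpO hσw hσh
  have h2 := E.sqrt_sub_le_sum_received hM hpI hpF hpO hσw hσh hw hh
  refine ⟨q, max_le ?_ ?_⟩
  · refine le_of_mul_le_mul_left ?_ hP'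
    calc _ = p.C * L.G / M - P * M := by field_simp
      _ ≤ _ := by linarith
  · refine le_of_mul_le_mul_left ?_ hP'
    calc _ = 2 * (√(p.pI * p.pF * p.pO) * √((L.σw : ℝ) * (L.σh : ℝ)) * L.G
          / √((L.wF : ℝ) * (L.hF : ℝ) * M) - P * M) := by
          rw [mul_comm (P : ℝ) √_]; field_simp
      _ ≤ _ := by linarith
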